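/- Let $K$ be a compact topological group, let $V$ be a finite-dimensional real vector space with its usual topology, and let $\tau$ be a continuous linear representation of $K$ on $V$, i.e. a homomorphism $\tau : K \to GL(V)$ such that the map $K \times V \to V$, $(k,v) \mapsto \tau(k)v$, is continuous. Let $G = K \ltimes_\tau V$ be the semidirect product: the set $K \times V$ with the product topology and the multiplication $(k,v)(l,w) = (kl,\, v + \tau(k)w)$. Identify each $v \in V$ with the element $(e,v)$ of $G$. Then for every discrete subgroup $\Gamma$ of $G$ there is a real linear subspace $W \subset V$ such that $\Gamma$ and $W$ are strongly similar in $G$, that is, there exist an element $g \in G$ and a compact subset $S \subset G$ with $$\Gamma \subset g W S \quad\text{and}\quad W \subset g\, \Gamma S.$$ -/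

import Mathlib

open scoped Pointwise

/-- Two subsets `L`, `H` of a topological group are (right) strongly similar if there are one
element `g` and one compact set `S` with `L ⊆ g H S` and `H ⊆ g L S`. -/
def StronglySimilar {G : Type*} [Group G] [TopologicalSpace G] (L H : Set G) : Prop :=
  ∃ (g : G) (S : Set G), IsCompact S ∧ L ⊆ {g} * H * S ∧ H ⊆ {g} * L * S

/-- The product topology on a semidirect product. -/
instance SemidirectProduct.instTopologicalSpaceProd {N G : Type*} [Group N] [Group G]
    [TopologicalSpace N] [TopologicalSpace G] (φ : G →* MulAut N) :
    TopologicalSpace (N ⋊[φ] G) :=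
  TopologicalSpace.induced (fun x => (x.left, x.right)) inferInstance

/-- A linear representation of a group `K` on `V`, as an action of `K` on the additive group of `V`
(written multiplicatively) by group automorphisms. -/
def Representation.toMulAutMultiplicative {K V : Type*} [Group K] [AddCommGroup V] [Module ℝ V]
    (τ : Representation ℝ K V) : K →* MulAut (Multiplicative V) where
  toFun k :=
    { toFun := fun x => Multiplicative.ofAdd (τ k x.toAdd)
      invFun := fun x => Multiplicative.ofAdd (τ k⁻¹ x.toAdd)
      left_inv := fun x => by simp
      right_inv := fun x => by simp
      map_mul' := fun x y => by simp }
  map_one' := by ext x; simp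
  map_mul' k l := by ext x; simp

/-- The group `K ⋉_τ V`. Its elements are pairs of a vector and an element of `K`, the product is
`(v, k) (w, l) = (v + τ k w, k l)`, and the topology is that of `V × K`. -/
abbrev Representation.SemidirectGroup {K V : Type*} [Group K] [AddCommGroup V] [Module ℝ V]
    (τ : Representation ℝ K V) : Type _ :=
  Multiplicative V ⋊[τ.toMulAutMultiplicative] K

/-- A vector `v`, regarded as the element `(v, 1)` of `K ⋉_τ V`. -/
def Representation.translation {K V : Type*} [Group K] [AddCommGroup V] [Module ℝ V]
    (τ : Representation ℝ K V) (v : V) : τ.SemidirectGroup :=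
  SemidirectProduct.inl (Multiplicative.ofAdd v)

/-- If `K` is a topological group and the action map is continuous, then `K ⋉_τ V` is a topological
group. -/
theorem Representation.isTopologicalGroup_semidirectGroup {K V : Type*}
    [Group K] [TopologicalSpace K] [IsTopologicalGroup K]
    [NormedAddCommGroup V] [NormedSpace ℝ V] (τ : Representation ℝ K V)
    (hτ : Continuous fun p : K × V => τ p.1 p.2) : IsTopologicalGroup τ.SemidirectGroup := by
  have hi : Topology.IsInducing
      (fun x : τ.SemidirectGroup => ((x.left, x.right) : Multiplicative V × K)) := ⟨rfl⟩
  have hl : Continuous fun x : τ.SemidirectGroup => (x.left.toAdd : V) :=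
    continuous_toAdd.comp (continuous_fst.comp hi.continuous)
  have hr : Continuous fun x : τ.SemidirectGroup => x.right := continuous_snd.comp hi.continuous
  refine { continuous_mul := ?_, continuous_inv := ?_ }
  · rw [hi.continuous_iff]
    refine Continuous.prodMk ?_ ?_
    · exact continuous_ofAdd.comp ((hl.comp continuous_fst).add
        (hτ.comp ((hr.comp continuous_fst).prodMk (hl.comp continuous_snd))))
    · exact (hr.comp continuous_fst).mul (hr.comp continuous_snd)
  · rw [hi.continuous_iff]
    refine Continuous.prodMk ?_ ?_
    · exact continuous_ofAdd.comp (hτ.comp (hr.inv.prodMk hl.neg))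
    · exact hr.inv

/-!
Averaging an inner product over `K` lets `K` act on `V` by linear isometries, so that `K ⋉ V` acts
properly by rigid motions and only finitely many elements of `Γ` move the origin a given distance.

For `g` and `x` in `Γ` whose linear parts are within `1 / 4` of the identity, the iterated
commutators of `x` with `g` contract towards the identity, hence reach it after finitely many steps.
Retracing these steps, the linear part of each commutator is trivial, because its powers stay close
to `1`, and then its translation part is both fixed by the linear part of `g` and orthogonal to the
vectors fixed by it, hence zero. So `g` and `x` commute. By compactness, finitely many translates of
the commutative group generated by such elements cover `Γ`.

For a commutative group of rigid motions, let `B` be the space of directions in which the orbit of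
the origin is bounded. The vectors `(A - 1) v`, with `A` the linear part of a group element, all lie
in `B`, so the projection of the orbit to the orthogonal complement of `B` is an additive subgroup,
which is at finite Hausdorff distance both from the orbit and from its own linear span.
-/

open scoped commutatorElement RealInnerProductSpace

theorem commutatorElement_pow_left_of_commute {G : Type*} [Group G] {g x : G}
    (h : Commute g ⁅g, x⁆) (n : ℕ) : ⁅g ^ n, x⁆ = ⁅g, x⁆ ^ n := by
  induction n with
  | zero => simp
  | succ n ih =>
    calc ⁅g ^ (n + 1), x⁆ = g * ⁅g ^ n, x⁆ * g⁻¹ * ⁅g, x⁆ := by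
          rw [pow_succ', commutatorElement_def, commutatorElement_def, commutatorElement_def]; group
      _ = ⁅g, x⁆ ^ (n + 1) := by rw [ih, (h.pow_right n).eq, mul_inv_cancel_right, pow_succ]

section ContractiveRepresentation

variable {G R : Type*} [Group G] [NormedRing R] {ρ : G →* R}

theorem norm_map_commutatorElement_sub_one_le (hρ : ∀ g, ‖ρ g‖ ≤ 1) (g h : G) :
    ‖ρ ⁅g, h⁆ - 1‖ ≤ 2 * ‖ρ g - 1‖ * ‖ρ h - 1‖ := by
  have hunits := norm_commutator_units_sub_one_le (ρ.toHomUnits g) (ρ.toHomUnits h)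
  rw [← commutatorElement_def, ← map_commutatorElement] at hunits
  calc ‖ρ ⁅g, h⁆ - 1‖ ≤ 2 * ‖ρ g⁻¹‖ * ‖ρ h⁻¹‖ * ‖ρ g - 1‖ * ‖ρ h - 1‖ := hunits
    _ ≤ 2 * 1 * 1 * ‖ρ g - 1‖ * ‖ρ h - 1‖ := by gcongr <;> exact hρ _
    _ = 2 * ‖ρ g - 1‖ * ‖ρ h - 1‖ := by ring

theorem commute_map_of_map_commutatorElement_eq_one {M : Type*} [Monoid M] {σ : G →* M} {g h : G}
    (hgh : σ ⁅g, h⁆ = 1) : Commute (σ g) (σ h) := by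
  have hcomm : ⁅g, h⁆ * (h * g) = g * h := by rw [commutatorElement_def]; group
  calc σ g * σ h = σ ⁅g, h⁆ * (σ h * σ g) := by rw [← map_mul, ← map_mul, ← map_mul, hcomm]
    _ = σ h * σ g := by rw [hgh, one_mul]

variable [NormedAlgebra ℝ R]

theorem eq_one_of_forall_norm_pow_sub_one_le {c : R} {r : ℝ} (hr : r < 1)
    (h : ∀ n : ℕ, ‖c ^ n - 1‖ ≤ r) : c = 1 := by
  have hsq (d : R) (hd : ‖d - 1‖ ≤ r) : (2 - r) * ‖d - 1‖ ≤ ‖d ^ 2 - 1‖ := by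
    have hexpand : (2 : ℝ) • (d - 1) = (d ^ 2 - 1) - (d - 1) * (d - 1) := by
      rw [two_smul]; noncomm_ring
    have hnorm : 2 * ‖d - 1‖ ≤ ‖d ^ 2 - 1‖ + ‖d - 1‖ * ‖d - 1‖ := by
      rw [← Real.norm_ofNat 2, ← norm_smul, hexpand]
      exact (norm_sub_le _ _).trans (by gcongr; exact norm_mul_le _ _)
    nlinarith [norm_nonneg (d - 1)]
  have hgrowth (k : ℕ) : (2 - r) ^ k * ‖c - 1‖ ≤ ‖c ^ 2 ^ k - 1‖ := by
    induction k with
    | zero => simp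
    | succ k ih =>
      calc (2 - r) ^ (k + 1) * ‖c - 1‖ = (2 - r) * ((2 - r) ^ k * ‖c - 1‖) := by ring
        _ ≤ (2 - r) * ‖c ^ 2 ^ k - 1‖ := by gcongr; linarith
        _ ≤ ‖c ^ 2 ^ (k + 1) - 1‖ := by
          rw [pow_succ 2 k, pow_mul]; exact hsq _ (h _)
  by_contra hc
  have hpos : 0 < ‖c - 1‖ := norm_pos_iff.2 (sub_ne_zero.2 hc)
  obtain ⟨k, hk⟩ := pow_unbounded_of_one_lt (r / ‖c - 1‖) (show 1 < 2 - r by linarith)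
  rw [div_lt_iff₀ hpos] at hk
  linarith [hgrowth k, h (2 ^ k)]

-- The powers of `⁅g, x⁆` act as `⁅g ^ n, x⁆`, so they stay within distance `4 * ‖ρ x - 1‖` of `1`.
theorem map_commutatorElement_eq_one_of_commute (hρ : ∀ g, ‖ρ g‖ ≤ 1) {g x : G}
    (hx : ‖ρ x - 1‖ < 1 / 4) (hcomm : Commute (ρ g) (ρ ⁅g, x⁆)) : ρ ⁅g, x⁆ = 1 := by
  have hpow (n : ℕ) : ρ ⁅g, x⁆ ^ n = ρ ⁅g ^ n, x⁆ := by
    have hunits : Commute (ρ.toHomUnits g) ⁅ρ.toHomUnits g, ρ.toHomUnits x⁆ := by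
      rw [← map_commutatorElement]; exact Units.ext hcomm
    have h := commutatorElement_pow_left_of_commute hunits n
    rw [← map_pow, ← map_commutatorElement, ← map_commutatorElement, ← map_pow] at h
    rw [← map_pow]
    exact (congrArg Units.val h).symm
  refine eq_one_of_forall_norm_pow_sub_one_le (r := 4 * ‖ρ x - 1‖) (by linarith) fun n => ?_
  have hdist : ‖ρ (g ^ n) - 1‖ ≤ 2 := by
    rw [← map_one ρ]
    linarith [norm_sub_le (ρ (g ^ n)) (ρ 1), hρ (g ^ n), hρ 1]
  calc ‖ρ ⁅g, x⁆ ^ n - 1‖ ≤ 2 * ‖ρ (g ^ n) - 1‖ * ‖ρ x - 1‖ := by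
        rw [hpow]; exact norm_map_commutatorElement_sub_one_le hρ _ _
    _ ≤ 2 * 2 * ‖ρ x - 1‖ := by gcongr
    _ = 4 * ‖ρ x - 1‖ := by ring

end ContractiveRepresentation

section Translates

variable {G R : Type*} [Group G] [NormedRing R] [ProperSpace R] {ρ : G →* R}

theorem exists_finite_forall_norm_map_mul_inv_sub_one_lt (hρ : ∀ g, ‖ρ g‖ ≤ 1) (s : Set G)
    {ε : ℝ} (hε : 0 < ε) :
    ∃ t ⊆ s, t.Finite ∧ ∀ g ∈ s, ∃ r ∈ t, ‖ρ (g * r⁻¹) - 1‖ < ε := by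
  have hbdd : TotallyBounded (ρ '' s) :=
    (isCompact_closedBall (0 : R) 1).totallyBounded.subset <| by
      rintro _ ⟨g, -, rfl⟩; simpa using hρ g
  obtain ⟨t, hts, ht, hcover⟩ :=
    Set.exists_subset_image_finite_and.1 (Metric.finite_approx_of_totallyBounded hbdd ε hε)
  refine ⟨t, hts, ht, fun g hg => ?_⟩
  obtain ⟨r, hr, hgr⟩ : ∃ r ∈ t, ‖ρ g - ρ r‖ < ε := by
    simpa [dist_eq_norm] using hcover (Set.mem_image_of_mem ρ hg)
  refine ⟨r, hr, ?_⟩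
  have hfactor : ρ (g * r⁻¹) - 1 = (ρ g - ρ r) * ρ r⁻¹ := by
    rw [sub_mul, ← map_mul, ← map_mul, mul_inv_cancel, map_one]
  calc ‖ρ (g * r⁻¹) - 1‖ ≤ ‖ρ g - ρ r‖ * ‖ρ r⁻¹‖ := hfactor ▸ norm_mul_le _ _
    _ ≤ ‖ρ g - ρ r‖ := mul_le_of_le_one_right (norm_nonneg _) (hρ _)
    _ < ε := hgr

end Translates

theorem induction_on_finite_sublevels {α β : Type*} [LinearOrder β] {s : Set α} {u : α → β}
    (hfin : ∀ b, {x ∈ s | u x ≤ b}.Finite) {p : α → Prop}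
    (ind : ∀ x ∈ s, (∀ y ∈ s, u y < u x → p y) → p x) : ∀ x ∈ s, p x := by
  by_contra! ⟨x, hx, hpx⟩
  obtain ⟨m, ⟨⟨hm, hmx⟩, hpm⟩, hmin⟩ :=
    Set.exists_min_image {y ∈ {y ∈ s | u y ≤ u x} | ¬p y} u ((hfin (u x)).subset fun _ h => h.1)
      ⟨x, ⟨hx, le_rfl⟩, hpx⟩
  refine hpm (ind m hm fun y hy hym => ?_)
  by_contra hpy
  exact hym.not_ge (hmin y ⟨⟨hy, hym.le.trans hmx⟩, hpy⟩)

section RigidMotion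

variable {E : Type*} [NormedAddCommGroup E]

section Normed

variable [NormedSpace ℝ E]

/-- The linear part of a rigid motion, valued in the normed algebra of operators so that its
distance to the identity can be measured. -/
noncomputable def linearPart : (E ≃ᵃⁱ[ℝ] E) →* (E →L[ℝ] E) where
  toFun g := g.linearIsometryEquiv
  map_one' := rfl
  map_mul' _ _ := rfl

theorem apply_eq_linearPart_add (g : E ≃ᵃⁱ[ℝ] E) (v : E) : g v = linearPart g v + g 0 := by
  have h : g (v + 0) = linearPart g v + g 0 := g.map_vadd 0 v
  rwa [add_zero] at h

theorem norm_linearPart_apply (g : E ≃ᵃⁱ[ℝ] E) (v : E) : ‖linearPart g v‖ = ‖v‖ :=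
  g.linearIsometryEquiv.norm_map v

theorem norm_linearPart_le_one (g : E ≃ᵃⁱ[ℝ] E) : ‖linearPart g‖ ≤ 1 :=
  ContinuousLinearMap.opNorm_le_bound _ zero_le_one fun v => by
    rw [norm_linearPart_apply, one_mul]

theorem eq_one_of_linearPart_eq_one {g : E ≃ᵃⁱ[ℝ] E} (hlin : linearPart g = 1) (hzero : g 0 = 0) :
    g = 1 := by
  ext v
  rw [apply_eq_linearPart_add, hlin, hzero]
  simp

theorem norm_inv_mul_apply_zero (g h : E ≃ᵃⁱ[ℝ] E) : ‖(g⁻¹ * h) 0‖ = dist (g 0) (h 0) := by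
  calc ‖(g⁻¹ * h) 0‖ = dist (g ((g⁻¹ * h) 0)) (g 0) := by
        rw [AffineIsometryEquiv.dist_map, dist_zero_right]
    _ = dist (h 0) (g 0) := by simp
    _ = dist (g 0) (h 0) := dist_comm _ _

theorem norm_apply_le (g : E ≃ᵃⁱ[ℝ] E) (v : E) : ‖g v‖ ≤ ‖v‖ + ‖g 0‖ := by
  rw [apply_eq_linearPart_add, ← norm_linearPart_apply g v]
  exact norm_add_le _ _

theorem commutatorElement_apply_zero (g h : E ≃ᵃⁱ[ℝ] E) :
    ⁅g, h⁆ 0 = (linearPart g - 1) (h 0) - (linearPart h - 1) (g 0)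
      - (linearPart ⁅g, h⁆ - 1) (h (g 0)) := by
  have hcomm : ⁅g, h⁆ (h (g 0)) = g (h 0) := by
    simp [commutatorElement_def]
  rw [apply_eq_linearPart_add ⁅g, h⁆, apply_eq_linearPart_add g (h 0)] at hcomm
  simp only [sub_apply, one_apply_eq_self]
  rw [eq_sub_of_add_eq' hcomm, apply_eq_linearPart_add h (g 0)]
  abel

theorem linearPart_apply_zero_eq_of_commute {g c : E ≃ᵃⁱ[ℝ] E} (hcomm : Commute g c)
    (hc : linearPart c = 1) : linearPart g (c 0) = c 0 := by
  have h : g (c 0) = c (g 0) := DFunLike.congr_fun hcomm.eq 0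
  rw [apply_eq_linearPart_add g (c 0), apply_eq_linearPart_add c (g 0), hc, add_comm] at h
  exact add_left_cancel h

/-- The deviation of a rigid motion from the identity: the displacement of the origin plus `c`
times the distance of the linear part to `1`. With a weight `c` large compared to `‖g 0‖`, it
decreases under `x ↦ ⁅g, x⁆` for linear parts close to `1`. -/
noncomputable def deviation (c : ℝ) (g : E ≃ᵃⁱ[ℝ] E) : ℝ :=
  ‖g 0‖ + c * ‖linearPart g - 1‖

theorem norm_linearPart_commutatorElement_sub_one_le {g x : E ≃ᵃⁱ[ℝ] E}
    (hg : ‖linearPart g - 1‖ < 1 / 4) :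
    ‖linearPart ⁅g, x⁆ - 1‖ ≤ 1 / 2 * ‖linearPart x - 1‖ :=
  (norm_map_commutatorElement_sub_one_le norm_linearPart_le_one g x).trans <| by
    gcongr; linarith

theorem norm_commutatorElement_apply_zero_le {g x : E ≃ᵃⁱ[ℝ] E}
    (hg : ‖linearPart g - 1‖ < 1 / 4) (hx : ‖linearPart x - 1‖ < 1 / 4) :
    ‖⁅g, x⁆ 0‖ ≤ 1 / 2 * ‖x 0‖ + 3 / 2 * ‖g 0‖ * ‖linearPart x - 1‖ := by
  have hlin := norm_linearPart_commutatorElement_sub_one_le (x := x) hg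
  calc ‖⁅g, x⁆ 0‖
      ≤ ‖(linearPart g - 1) (x 0)‖ + ‖(linearPart x - 1) (g 0)‖
        + ‖(linearPart ⁅g, x⁆ - 1) (x (g 0))‖ := by
        rw [commutatorElement_apply_zero]
        exact (norm_sub_le _ _).trans (by gcongr; exact norm_sub_le _ _)
    _ ≤ 1 / 4 * ‖x 0‖ + ‖linearPart x - 1‖ * ‖g 0‖
        + 1 / 2 * ‖linearPart x - 1‖ * (‖g 0‖ + ‖x 0‖) := by
        gcongr
        · exact ContinuousLinearMap.le_of_opNorm_le _ hg.le _
        · exact ContinuousLinearMap.le_opNorm _ _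
        · exact ContinuousLinearMap.le_of_opNorm_le_of_le _ hlin (norm_apply_le x (g 0))
    _ ≤ 1 / 2 * ‖x 0‖ + 3 / 2 * ‖g 0‖ * ‖linearPart x - 1‖ := by
        nlinarith [norm_nonneg (x 0)]

theorem deviation_commutatorElement_lt {g x : E ≃ᵃⁱ[ℝ] E}
    (hg : ‖linearPart g - 1‖ < 1 / 4) (hx : ‖linearPart x - 1‖ < 1 / 4) (hne : x ≠ 1) :
    deviation (4 * ‖g 0‖ + 1) ⁅g, x⁆ < deviation (4 * ‖g 0‖ + 1) x := by
  have hpos : 0 < ‖x 0‖ + ‖linearPart x - 1‖ := by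
    by_contra! hle
    have hzero := norm_nonneg (x 0)
    have hlin := norm_nonneg (linearPart x - 1)
    exact hne (eq_one_of_linearPart_eq_one (sub_eq_zero.1 (norm_eq_zero.1 (by linarith)))
      (norm_eq_zero.1 (by linarith)))
  calc deviation (4 * ‖g 0‖ + 1) ⁅g, x⁆
      ≤ (1 / 2 * ‖x 0‖ + 3 / 2 * ‖g 0‖ * ‖linearPart x - 1‖)
        + (4 * ‖g 0‖ + 1) * (1 / 2 * ‖linearPart x - 1‖) := by
        unfold deviation
        gcongr
        · exact norm_commutatorElement_apply_zero_le hg hx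
        · exact norm_linearPart_commutatorElement_sub_one_le hg
    _ < deviation (4 * ‖g 0‖ + 1) x := by
        unfold deviation
        nlinarith [mul_nonneg (norm_nonneg (g 0)) (norm_nonneg (linearPart x - 1))]

end Normed

variable [InnerProductSpace ℝ E]

theorem inner_linearPart_sub_one_apply_eq_zero {g : E ≃ᵃⁱ[ℝ] E} {w : E}
    (hw : linearPart g w = w) (v : E) : ⟪w, (linearPart g - 1) v⟫ = 0 := by
  have hinner : ⟪linearPart g w, linearPart g v⟫ = ⟪w, v⟫ := g.linearIsometryEquiv.inner_map_map w v
  rw [hw] at hinner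
  rw [sub_apply, one_apply_eq_self, inner_sub_right, hinner, sub_self]

variable {Γ : Subgroup (E ≃ᵃⁱ[ℝ] E)}

theorem linearPart_commutatorElement_eq_one_of_iterate {g x : E ≃ᵃⁱ[ℝ] E}
    (hx : ‖linearPart x - 1‖ < 1 / 4) (hlin : linearPart ⁅g, ⁅g, x⁆⁆ = 1)
    (hcomm : Commute g ⁅g, ⁅g, x⁆⁆) : linearPart ⁅g, x⁆ = 1 ∧ Commute g ⁅g, x⁆ := by
  have hone : linearPart ⁅g, x⁆ = 1 := map_commutatorElement_eq_one_of_commute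
    norm_linearPart_le_one hx (commute_map_of_map_commutatorElement_eq_one hlin)
  have htrans : ⁅g, ⁅g, x⁆⁆ 0 = (linearPart g - 1) (⁅g, x⁆ 0) := by
    rw [commutatorElement_apply_zero, hlin, hone]; simp
  have hzero : ⁅g, ⁅g, x⁆⁆ 0 = 0 := by
    rw [← inner_self_eq_zero (𝕜 := ℝ)]
    nth_rewrite 2 [htrans]
    exact inner_linearPart_sub_one_apply_eq_zero (linearPart_apply_zero_eq_of_commute hcomm hlin) _
  exact ⟨hone, commutatorElement_eq_one_iff_commute.1 (eq_one_of_linearPart_eq_one hlin hzero)⟩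

theorem linearPart_commutatorElement_eq_one_and_commute
    (hΓ : ∀ R : ℝ, {g ∈ Γ | ‖g 0‖ ≤ R}.Finite) {g : E ≃ᵃⁱ[ℝ] E} (hgΓ : g ∈ Γ)
    (hg : ‖linearPart g - 1‖ < 1 / 4) :
    ∀ x ∈ {x ∈ Γ | ‖linearPart x - 1‖ < 1 / 4},
      linearPart ⁅g, x⁆ = 1 ∧ Commute g ⁅g, x⁆ := by
  have hfin (R : ℝ) :
      {x ∈ {x ∈ Γ | ‖linearPart x - 1‖ < 1 / 4} | deviation (4 * ‖g 0‖ + 1) x ≤ R}.Finite :=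
    (hΓ R).subset fun x hx =>
      ⟨hx.1.1, (le_add_of_nonneg_right (by positivity)).trans hx.2⟩
  refine induction_on_finite_sublevels hfin fun x ⟨hxΓ, hx⟩ ih => ?_
  by_cases hne : x = 1
  · simp [hne]
  have hsmall : ‖linearPart ⁅g, x⁆ - 1‖ < 1 / 4 := by
    linarith [norm_linearPart_commutatorElement_sub_one_le (x := x) hg,
      norm_nonneg (linearPart x - 1)]
  have hmem : ⁅g, x⁆ ∈ Γ :=
    Γ.mul_mem (Γ.mul_mem (Γ.mul_mem hgΓ hxΓ) (Γ.inv_mem hgΓ)) (Γ.inv_mem hxΓ)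
  obtain ⟨hlin, hcomm⟩ := ih ⁅g, x⁆ ⟨hmem, hsmall⟩ (deviation_commutatorElement_lt hg hx hne)
  exact linearPart_commutatorElement_eq_one_of_iterate hx hlin hcomm

theorem commute_of_norm_linearPart_sub_one_lt
    (hΓ : ∀ R : ℝ, {g ∈ Γ | ‖g 0‖ ≤ R}.Finite) {g x : E ≃ᵃⁱ[ℝ] E} (hgΓ : g ∈ Γ) (hxΓ : x ∈ Γ)
    (hg : ‖linearPart g - 1‖ < 1 / 4) (hx : ‖linearPart x - 1‖ < 1 / 4) : Commute g x := by
  obtain ⟨hlin, hcomm⟩ :=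
    linearPart_commutatorElement_eq_one_and_commute hΓ hgΓ hg x ⟨hxΓ, hx⟩
  obtain ⟨-, hcomm'⟩ := linearPart_commutatorElement_eq_one_and_commute hΓ hxΓ hx g ⟨hgΓ, hg⟩
  have hgfix := linearPart_apply_zero_eq_of_commute hcomm hlin
  have hxfix : linearPart x (⁅g, x⁆ 0) = ⁅g, x⁆ 0 := by
    refine linearPart_apply_zero_eq_of_commute ?_ hlin
    rw [← commutatorElement_inv]
    exact hcomm'.inv_right
  have htrans : ⁅g, x⁆ 0 = (linearPart g - 1) (x 0) - (linearPart x - 1) (g 0) := by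
    rw [commutatorElement_apply_zero, hlin]; simp
  have hzero : ⁅g, x⁆ 0 = 0 := by
    rw [← inner_self_eq_zero (𝕜 := ℝ)]
    nth_rewrite 2 [htrans]
    rw [inner_sub_right, inner_linearPart_sub_one_apply_eq_zero hgfix,
      inner_linearPart_sub_one_apply_eq_zero hxfix, sub_zero]
  exact commutatorElement_eq_one_iff_commute.1 (eq_one_of_linearPart_eq_one hlin hzero)

end RigidMotion

section CoarseDistance

open Metric

theorem hausdorffEDist_ne_top_of_forall_exists_dist_le {X : Type*} [PseudoMetricSpace X]
    {s t : Set X} {r₁ r₂ : ℝ} (hst : ∀ x ∈ s, ∃ y ∈ t, dist x y ≤ r₁)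
    (hts : ∀ y ∈ t, ∃ x ∈ s, dist x y ≤ r₂) : hausdorffEDist s t ≠ ⊤ := by
  refine ne_top_of_le_ne_top (ENNReal.ofReal_ne_top (r := max r₁ r₂))
    (hausdorffEDist_le_of_mem_edist ?_ ?_)
  · intro x hx
    obtain ⟨y, hy, hxy⟩ := hst x hx
    refine ⟨y, hy, ?_⟩
    rw [edist_dist]
    exact ENNReal.ofReal_le_ofReal (hxy.trans (le_max_left _ _))
  · intro y hy
    obtain ⟨x, hx, hxy⟩ := hts y hy
    refine ⟨x, hx, ?_⟩
    rw [edist_comm, edist_dist]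
    exact ENNReal.ofReal_le_ofReal (hxy.trans (le_max_right _ _))

theorem hausdorffEDist_addSubgroup_span_ne_top {V : Type*} [NormedAddCommGroup V]
    [NormedSpace ℝ V] [FiniteDimensional ℝ V] (Λ : AddSubgroup V) :
    hausdorffEDist (Λ : Set V) (Submodule.span ℝ (Λ : Set V)) ≠ ⊤ := by
  obtain ⟨b, hb, hspan, hli⟩ := exists_linearIndependent ℝ (Λ : Set V)
  have : Fintype b := hli.setFinite.fintype
  refine hausdorffEDist_ne_top_of_forall_exists_dist_le (r₁ := 0) (r₂ := ∑ i : b, ‖(i : V)‖)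
    (fun l hl => ⟨l, Submodule.subset_span hl, (dist_self l).le⟩) fun w hw => ?_
  rw [SetLike.mem_coe, ← hspan, ← Subtype.range_coe (s := b)] at hw
  obtain ⟨c, rfl⟩ := (Submodule.mem_span_range_iff_exists_fun ℝ).1 hw
  refine ⟨∑ i : b, ⌊c i⌋ • (i : V), sum_mem fun i _ => zsmul_mem (hb i.2) _, ?_⟩
  rw [dist_comm]
  calc dist (∑ i : b, c i • (i : V)) (∑ i : b, ⌊c i⌋ • (i : V))
      = ‖∑ i : b, Int.fract (c i) • (i : V)‖ := by
        simp only [dist_eq_norm, ← Finset.sum_sub_distrib, ← Int.cast_smul_eq_zsmul ℝ, ← sub_smul,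
          Int.self_sub_floor]
    _ ≤ ∑ i : b, ‖(i : V)‖ := norm_sum_le_of_le _ fun i _ => by
        rw [norm_smul, Real.norm_of_nonneg (Int.fract_nonneg _)]
        exact mul_le_of_le_one_left (norm_nonneg _) (Int.fract_lt_one _).le

end CoarseDistance

section BoundedDirections

variable {E : Type*} [NormedAddCommGroup E] [InnerProductSpace ℝ E]

/-- The directions in which a set is bounded: the vectors `x` for which the linear form `⟪·, x⟫` is
bounded on `s`. -/
def boundedDirections (s : Set E) : Submodule ℝ E where
  carrier := {x | ∃ C, ∀ p ∈ s, |⟪p, x⟫| ≤ C}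
  zero_mem' := ⟨0, by simp⟩
  add_mem' := by
    rintro x y ⟨C, hC⟩ ⟨D, hD⟩
    refine ⟨C + D, fun p hp => ?_⟩
    rw [inner_add_right]
    exact (abs_add_le _ _).trans (add_le_add (hC p hp) (hD p hp))
  smul_mem' := by
    rintro c x ⟨C, hC⟩
    refine ⟨|c| * C, fun p hp => ?_⟩
    rw [real_inner_smul_right, abs_mul]
    gcongr
    exact hC p hp

theorem exists_norm_starProjection_boundedDirections_le [CompleteSpace E] (s : Set E)
    [(boundedDirections s).HasOrthogonalProjection] :
    ∃ C, ∀ p ∈ s, ‖(boundedDirections s).starProjection p‖ ≤ C := by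
  obtain ⟨C, hC⟩ := banach_steinhaus
    (g := fun p : s => innerSL ℝ ((boundedDirections s).starProjection (p : E))) fun x => by
      obtain ⟨C, hC⟩ := (boundedDirections s).starProjection_apply_mem x
      refine ⟨C, fun p => ?_⟩
      rw [innerSL_apply_apply, Submodule.inner_starProjection_left_eq_right, Real.norm_eq_abs]
      exact hC p p.2
  exact ⟨C, fun p hp => (innerSL_apply_norm (𝕜 := ℝ) _).symm.trans_le (hC ⟨p, hp⟩)⟩

theorem hausdorffEDist_image_starProjection_boundedDirections_orthogonal_ne_top [CompleteSpace E]
    (s : Set E) [(boundedDirections s).HasOrthogonalProjection] :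
    Metric.hausdorffEDist s ((boundedDirections s)ᗮ.starProjection '' s) ≠ ⊤ := by
  obtain ⟨C, hC⟩ := exists_norm_starProjection_boundedDirections_le s
  have hdist (p : E) (hp : p ∈ s) : dist p ((boundedDirections s)ᗮ.starProjection p) ≤ C := by
    rw [dist_eq_norm, Submodule.starProjection_orthogonal_val, sub_sub_cancel]
    exact hC p hp
  refine hausdorffEDist_ne_top_of_forall_exists_dist_le
    (fun p hp => ⟨_, Set.mem_image_of_mem _ hp, hdist p hp⟩) (r₂ := C) ?_
  rintro _ ⟨p, hp, rfl⟩
  exact ⟨p, hp, hdist p hp⟩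

end BoundedDirections

section OriginOrbit

variable {E : Type*} [NormedAddCommGroup E]

/-- The orbit of the origin under a group of rigid motions. -/
def originOrbit [NormedSpace ℝ E] (Γ : Subgroup (E ≃ᵃⁱ[ℝ] E)) : Set E :=
  (fun g : E ≃ᵃⁱ[ℝ] E => g 0) '' Γ

theorem hausdorffEDist_originOrbit_ne_top_of_finite_cover [NormedSpace ℝ E]
    {Γ₀ Γ : Subgroup (E ≃ᵃⁱ[ℝ] E)} (hle : Γ₀ ≤ Γ) {t : Set (E ≃ᵃⁱ[ℝ] E)} (ht : t.Finite)
    (hcover : ∀ g ∈ Γ, ∃ r ∈ t, g * r⁻¹ ∈ Γ₀) :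
    Metric.hausdorffEDist (originOrbit Γ) (originOrbit Γ₀) ≠ ⊤ := by
  obtain ⟨D, hD⟩ := (ht.image fun r : E ≃ᵃⁱ[ℝ] E => ‖r 0‖).bddAbove
  refine hausdorffEDist_ne_top_of_forall_exists_dist_le (r₁ := D) (r₂ := 0) ?_ ?_
  · rintro _ ⟨g, hg, rfl⟩
    obtain ⟨r, hr, hgr⟩ := hcover g hg
    refine ⟨_, Set.mem_image_of_mem _ hgr, ?_⟩
    have hcoset : g 0 = (g * r⁻¹) (r 0) := by simp
    calc dist (g 0) ((g * r⁻¹) 0) = dist ((g * r⁻¹) (r 0)) ((g * r⁻¹) 0) := by rw [hcoset]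
      _ = ‖r 0‖ := by rw [AffineIsometryEquiv.dist_map, dist_zero_right]
      _ ≤ D := hD (Set.mem_image_of_mem _ hr)
  · rintro _ ⟨g, hg, rfl⟩
    exact ⟨g 0, Set.mem_image_of_mem _ (hle hg), (dist_self _).le⟩

variable [InnerProductSpace ℝ E]

theorem inner_linearPart_sub_one_apply (g : E ≃ᵃⁱ[ℝ] E) (w v : E) :
    ⟪w, (linearPart g - 1) v⟫ = ⟪(linearPart g⁻¹ - 1) w, v⟫ := by
  have hadj : ⟪w, linearPart g v⟫ = ⟪linearPart g⁻¹ w, v⟫ := by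
    rw [real_inner_comm]
    exact (g.linearIsometryEquiv.inner_map_eq_flip v w).trans (real_inner_comm _ _)
  rw [sub_apply, sub_apply, one_apply_eq_self, one_apply_eq_self, inner_sub_right, inner_sub_left,
    hadj]

variable {Γ : Subgroup (E ≃ᵃⁱ[ℝ] E)}

theorem linearPart_sub_one_apply_mem_boundedDirections
    [IsMulCommutative Γ] {h : E ≃ᵃⁱ[ℝ] E} (hh : h ∈ Γ) (v : E) :
    (linearPart h - 1) v ∈ boundedDirections (originOrbit Γ) := by
  refine ⟨2 * ‖h⁻¹ 0‖ * ‖v‖, ?_⟩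
  rintro _ ⟨g, hg, rfl⟩
  have hswap : (linearPart h⁻¹ - 1) (g 0) = (linearPart g - 1) (h⁻¹ 0) := by
    have hcomm := commutatorElement_apply_zero g h⁻¹
    rw [commutatorElement_eq_one_iff_mul_comm.2 (setLike_mul_comm hg (Γ.inv_mem hh)), map_one,
      sub_self, zero_apply, sub_zero] at hcomm
    exact (sub_eq_zero.1 hcomm.symm).symm
  rw [inner_linearPart_sub_one_apply, hswap]
  refine (abs_real_inner_le_norm _ _).trans ?_
  gcongr
  calc ‖(linearPart g - 1) (h⁻¹ 0)‖ ≤ ‖linearPart g (h⁻¹ 0)‖ + ‖h⁻¹ 0‖ := norm_sub_le _ _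
    _ = 2 * ‖h⁻¹ 0‖ := by rw [norm_linearPart_apply, two_mul]

theorem starProjection_boundedDirections_orthogonal_mul_apply_zero
    [(boundedDirections (originOrbit Γ)).HasOrthogonalProjection]
    [IsMulCommutative Γ] {g : E ≃ᵃⁱ[ℝ] E} (hg : g ∈ Γ) (h : E ≃ᵃⁱ[ℝ] E) :
    (boundedDirections (originOrbit Γ))ᗮ.starProjection ((g * h) 0) =
      (boundedDirections (originOrbit Γ))ᗮ.starProjection (g 0) +
        (boundedDirections (originOrbit Γ))ᗮ.starProjection (h 0) := by
  have hdecomp : (g * h) 0 = (linearPart g - 1) (h 0) + (g 0 + h 0) := by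
    rw [AffineIsometryEquiv.coe_mul, Function.comp_apply, apply_eq_linearPart_add, sub_apply,
      one_apply_eq_self]
    abel
  rw [hdecomp, map_add, map_add, Submodule.starProjection_orthogonal_apply_eq_zero
    (linearPart_sub_one_apply_mem_boundedDirections hg (h 0)), zero_add]

variable [FiniteDimensional ℝ E]

theorem exists_submodule_hausdorffEDist_originOrbit_ne_top_of_isMulCommutative
    [IsMulCommutative Γ] :
    ∃ W : Submodule ℝ E, Metric.hausdorffEDist (originOrbit Γ) W ≠ ⊤ := by
  have := FiniteDimensional.complete ℝ E
  set P := (boundedDirections (originOrbit Γ))ᗮ.starProjection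
  let projectedOrbit : Additive Γ →+ E := AddMonoidHom.mk'
    (fun g => P ((g.toMul : E ≃ᵃⁱ[ℝ] E) 0)) fun g h =>
      starProjection_boundedDirections_orthogonal_mul_apply_zero g.toMul.2 h.toMul
  have himage : P '' originOrbit Γ = projectedOrbit.range := by
    ext x
    simp only [originOrbit, Set.image_image, projectedOrbit]
    constructor
    · rintro ⟨g, hg, rfl⟩; exact ⟨Additive.ofMul ⟨g, hg⟩, rfl⟩
    · rintro ⟨g, rfl⟩; exact ⟨g.toMul, g.toMul.2, rfl⟩
  refine ⟨Submodule.span ℝ (projectedOrbit.range : Set E), ne_top_of_le_ne_top ?_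
    (Metric.hausdorffEDist_triangle (t := P '' originOrbit Γ))⟩
  refine ENNReal.add_ne_top.2
    ⟨hausdorffEDist_image_starProjection_boundedDirections_orthogonal_ne_top _, ?_⟩
  rw [himage]
  exact hausdorffEDist_addSubgroup_span_ne_top _

theorem exists_submodule_hausdorffEDist_originOrbit_ne_top
    (hΓ : ∀ R : ℝ, {g ∈ Γ | ‖g 0‖ ≤ R}.Finite) :
    ∃ W : Submodule ℝ E, Metric.hausdorffEDist (originOrbit Γ) W ≠ ⊤ := by
  have : ProperSpace (E →L[ℝ] E) := FiniteDimensional.proper ℝ _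
  set small : Set (E ≃ᵃⁱ[ℝ] E) := {g ∈ Γ | ‖linearPart g - 1‖ < 1 / 4}
  have : IsMulCommutative (Subgroup.closure small) :=
    Subgroup.isMulCommutative_closure fun g hg h hh =>
      commute_of_norm_linearPart_sub_one_lt hΓ hg.1 hh.1 hg.2 hh.2
  obtain ⟨t, htΓ, ht, hcover⟩ := exists_finite_forall_norm_map_mul_inv_sub_one_lt
    norm_linearPart_le_one (Γ : Set (E ≃ᵃⁱ[ℝ] E)) (ε := 1 / 4) (by norm_num)
  obtain ⟨W, hW⟩ := exists_submodule_hausdorffEDist_originOrbit_ne_top_of_isMulCommutative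
    (Γ := Subgroup.closure small)
  refine ⟨W, ne_top_of_le_ne_top (ENNReal.add_ne_top.2 ⟨?_, hW⟩) Metric.hausdorffEDist_triangle⟩
  refine hausdorffEDist_originOrbit_ne_top_of_finite_cover
    ((Subgroup.closure_le Γ).2 fun g hg => hg.1) ht fun g hg => ?_
  obtain ⟨r, hr, hgr⟩ := hcover g hg
  exact ⟨r, hr, Subgroup.subset_closure ⟨Γ.mul_mem hg (Γ.inv_mem (htΓ hr)), hgr⟩⟩

end OriginOrbit

section Unitarization

open MeasureTheory Module

/-- The action by linear isometries given by a norm-preserving representation. -/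
def isometryHom {K E : Type*} [Group K] [SeminormedAddCommGroup E] [Module ℝ E]
    (ρ : Representation ℝ K E) (hρ : ∀ k v, ‖ρ k v‖ = ‖v‖) : K →* (E ≃ₗᵢ[ℝ] E) where
  toFun k :=
    { LinearMap.GeneralLinearGroup.generalLinearEquiv ℝ E (ρ.asGroupHom k) with
      norm_map' := hρ k }
  map_one' := by ext v; simp
  map_mul' k l := by ext v; exact LinearMap.congr_fun (map_mul ρ k l) v

theorem exists_linearEquiv_euclideanSpace_norm_sq_eq {V : Type*} [AddCommGroup V] [Module ℝ V]
    [FiniteDimensional ℝ V] (c : InnerProductSpace.Core ℝ V) :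
    ∃ e : V ≃ₗ[ℝ] EuclideanSpace ℝ (Fin (finrank ℝ V)), ∀ v, ‖e v‖ ^ 2 = c.inner v v := by
  let : NormedAddCommGroup V := c.toNormedAddCommGroup
  let : InnerProductSpace ℝ V := .ofCore c.toCore
  refine ⟨(stdOrthonormalBasis ℝ V).repr.toLinearEquiv, fun v => ?_⟩
  calc ‖(stdOrthonormalBasis ℝ V).repr v‖ ^ 2 = ‖v‖ ^ 2 := by rw [LinearIsometryEquiv.norm_map]
    _ = ⟪v, v⟫ := (real_inner_self_eq_norm_sq v).symm

variable {K V : Type*} [Group K] [TopologicalSpace K] [IsTopologicalGroup K] [CompactSpace K]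
  [AddCommGroup V] [Module ℝ V] [TopologicalSpace V] [IsTopologicalAddGroup V]
  [ContinuousSMul ℝ V] [T2Space V] [FiniteDimensional ℝ V] {τ : Representation ℝ K V}

theorem exists_innerProductSpaceCore_invariant (hτ : ∀ v, Continuous fun k => τ k v) :
    ∃ c : InnerProductSpace.Core ℝ V, ∀ k v w, c.inner (τ k v) (τ k w) = c.inner v w := by
  borelize K
  let μ : Measure K := Measure.haarMeasure ⊤
  let f (v w : V) (k : K) : ℝ := ⟪toEuclidean (τ k⁻¹ v), toEuclidean (τ k⁻¹ w)⟫
  have hf (v w : V) : Continuous (f v w) :=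
    (toEuclidean.continuous.comp ((hτ v).comp continuous_inv)).inner
      (toEuclidean.continuous.comp ((hτ w).comp continuous_inv))
  have hint (v w : V) : Integrable (f v w) μ :=
    (hf v w).integrable_of_hasCompactSupport (.of_compactSpace _)
  have hnonneg (v : V) (k : K) : 0 ≤ f v v k := real_inner_self_nonneg
  let c : InnerProductSpace.Core ℝ V :=
    { inner v w := ∫ k, f v w k ∂μ
      conj_inner_symm v w := integral_congr_ae (.of_forall fun k => real_inner_comm _ _)
      re_inner_nonneg v := integral_nonneg (hnonneg v)
      add_left u v w := by
        rw [← integral_add (hint u w) (hint v w)]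
        simp only [f, map_add, inner_add_left]
      smul_left v w r := by
        rw [conj_trivial, ← integral_const_mul]
        simp only [f, map_smul, real_inner_smul_left]
      definite v hv := by
        by_contra hne
        refine ((hf v v).integral_pos_of_hasCompactSupport_nonneg_nonzero
          (.of_compactSpace _) (hnonneg v) (x := 1) ?_).ne' hv
        simpa [f] using hne }
  refine ⟨c, fun l v w => ?_⟩
  calc ∫ k, f (τ l v) (τ l w) k ∂μ = ∫ k, f v w (l⁻¹ * k) ∂μ := by
        simp only [f, mul_inv_rev, inv_inv, map_mul, End.mul_apply]
    _ = ∫ k, f v w k ∂μ := integral_mul_left_eq_self _ _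

theorem exists_conj_linearIsometryEquiv (hτ : ∀ v, Continuous fun k => τ k v) :
    ∃ (e : V ≃L[ℝ] EuclideanSpace ℝ (Fin (finrank ℝ V)))
      (σ : K →* (EuclideanSpace ℝ (Fin (finrank ℝ V)) ≃ₗᵢ[ℝ] EuclideanSpace ℝ (Fin (finrank ℝ V)))),
      ∀ k v, e (τ k v) = σ k (e v) := by
  obtain ⟨c, hc⟩ := exists_innerProductSpaceCore_invariant hτ
  obtain ⟨e, he⟩ := exists_linearEquiv_euclideanSpace_norm_sq_eq c
  have hnorm (k : K) (v : V) : ‖e (τ k v)‖ = ‖e v‖ := by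
    rw [← sq_eq_sq₀ (norm_nonneg _) (norm_nonneg _), he, he, hc]
  let ρ : Representation ℝ K (EuclideanSpace ℝ (Fin (finrank ℝ V))) :=
    (e.conjRingEquiv : _ →* _).comp τ
  have hρ (k : K) (x) : ‖ρ k x‖ = ‖x‖ := by
    change ‖e (τ k (e.symm x))‖ = ‖x‖
    rw [hnorm, e.apply_symm_apply]
  refine ⟨e.toContinuousLinearEquiv, isometryHom ρ hρ, fun k v => ?_⟩
  change e (τ k v) = e (τ k (e.symm (e v)))
  rw [e.symm_apply_apply]

end Unitarization

-- As `G` need not be Hausdorff, `Γ` need not be closed in `G`.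
theorem finite_inter_of_isCompact_of_discrete {G : Type*} [Group G] [TopologicalSpace G]
    [IsTopologicalGroup G] (Γ : Subgroup G) [DiscreteTopology Γ] {C : Set G} (hC : IsCompact C) :
    (C ∩ Γ).Finite := by
  obtain ⟨U, hU, hUΓ⟩ : ∃ U ∈ nhds (1 : G), ∀ x ∈ U, x ∈ Γ → x = 1 := by
    obtain ⟨U, hU, hsub⟩ := mem_nhds_subtype _ _ _ |>.1 (show ({1} : Set Γ) ∈ nhds (1 : Γ) by simp)
    exact ⟨U, hU, fun x hx hxΓ => congrArg Subtype.val (@hsub ⟨x, hxΓ⟩ hx)⟩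
  obtain ⟨N, hN, hdiv⟩ := exists_nhds_split_inv hU
  obtain ⟨t, -, hcover⟩ := hC.elim_nhds_subcover (fun x => (· * x⁻¹) ⁻¹' N) fun x _ =>
    (continuous_mul_const x⁻¹).continuousAt.preimage_mem_nhds (by simpa using hN)
  have hsubsingleton (x : G) : (((· * x⁻¹) ⁻¹' N) ∩ Γ).Subsingleton := fun g hg h hh => by
    have hone : g * x⁻¹ / (h * x⁻¹) = 1 :=
      hUΓ _ (hdiv _ hg.1 _ hh.1) (by simpa using Γ.div_mem hg.2 hh.2)
    simpa [div_eq_one] using hone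
  refine (t.finite_toSet.biUnion fun x _ => (hsubsingleton x).finite).subset ?_
  rintro g ⟨hg, hgΓ⟩
  obtain ⟨x, hx, hgx⟩ := Set.mem_iUnion₂.1 (hcover hg)
  exact Set.mem_iUnion₂.2 ⟨x, hx, hgx, hgΓ⟩

section ProperAction

variable {G E : Type*} [Group G] [TopologicalSpace G] [NormedAddCommGroup E]

theorem stronglySimilar_of_hausdorffEDist_ne_top [NormedSpace ℝ E] {φ : G →* (E ≃ᵃⁱ[ℝ] E)}
    (hφ : ∀ R : ℝ, IsCompact {x | ‖φ x 0‖ ≤ R}) {L H : Set G}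
    (hLH : Metric.hausdorffEDist ((φ · 0) '' L) ((φ · 0) '' H) ≠ ⊤) : StronglySimilar L H := by
  obtain ⟨R, hR⟩ := exists_gt (Metric.hausdorffDist ((φ · 0) '' L) ((φ · 0) '' H))
  refine ⟨1, {x | ‖φ x 0‖ ≤ R}, hφ R, fun x hx => ?_, fun y hy => ?_⟩
  · obtain ⟨_, ⟨y, hy, rfl⟩, hxy⟩ :=
      Metric.exists_dist_lt_of_hausdorffDist_lt (Set.mem_image_of_mem _ hx) hR hLH
    refine ⟨y, ⟨1, rfl, y, hy, one_mul y⟩, y⁻¹ * x, ?_, mul_inv_cancel_left y x⟩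
    rw [Set.mem_ofPred_eq, map_mul, map_inv, norm_inv_mul_apply_zero, dist_comm]
    exact hxy.le
  · obtain ⟨_, ⟨x, hx, rfl⟩, hxy⟩ :=
      Metric.exists_dist_lt_of_hausdorffDist_lt' (Set.mem_image_of_mem _ hy) hR hLH
    refine ⟨x, ⟨1, rfl, x, hx, one_mul x⟩, x⁻¹ * y, ?_, mul_inv_cancel_left x y⟩
    rw [Set.mem_ofPred_eq, map_mul, map_inv, norm_inv_mul_apply_zero]
    exact hxy.le

variable [IsTopologicalGroup G] [InnerProductSpace ℝ E] [FiniteDimensional ℝ E]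

theorem exists_submodule_hausdorffEDist_ne_top_of_discrete {φ : G →* (E ≃ᵃⁱ[ℝ] E)}
    (hφ : ∀ R : ℝ, IsCompact {x | ‖φ x 0‖ ≤ R}) (Γ : Subgroup G) [DiscreteTopology Γ] :
    ∃ W : Submodule ℝ E, Metric.hausdorffEDist ((φ · 0) '' (Γ : Set G)) W ≠ ⊤ := by
  have hfin (R : ℝ) : {g ∈ Γ.map φ | ‖g 0‖ ≤ R}.Finite := by
    refine ((finite_inter_of_isCompact_of_discrete Γ (hφ R)).image φ).subset ?_
    rintro _ ⟨⟨x, hx, rfl⟩, hxR⟩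
    exact ⟨x, ⟨hxR, hx⟩, rfl⟩
  obtain ⟨W, hW⟩ := exists_submodule_hausdorffEDist_originOrbit_ne_top hfin
  rw [originOrbit, Subgroup.coe_map, Set.image_image] at hW
  exact ⟨W, hW⟩

end ProperAction

section SemidirectGroup

variable {K V E : Type*} [Group K] [AddCommGroup V] [Module ℝ V] [NormedAddCommGroup E]
  [NormedSpace ℝ E] {τ : Representation ℝ K V} {σ : K →* (E ≃ₗᵢ[ℝ] E)}

/-- The action of `K ⋉_τ V` by rigid motions `v ↦ σ k v + e w` of `E`, where `e` intertwines `τ`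
with the isometric action `σ`. -/
noncomputable def rigidMotionHom (e : V →ₗ[ℝ] E) (he : ∀ k v, e (τ k v) = σ k (e v)) :
    τ.SemidirectGroup →* (E ≃ᵃⁱ[ℝ] E) where
  toFun x := .constVAdd ℝ E (e x.left.toAdd) * (σ x.right).toAffineIsometryEquiv
  map_one' := by ext v; simp
  map_mul' x y := by
    ext v
    change e (x.left.toAdd + τ x.right y.left.toAdd) + σ (x.right * y.right) v =
      e x.left.toAdd + σ x.right (e y.left.toAdd + σ y.right v)
    rw [map_add, he, map_mul, map_add, add_assoc]
    rfl

theorem rigidMotionHom_apply_zero (e : V →ₗ[ℝ] E) (he : ∀ k v, e (τ k v) = σ k (e v))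
    (x : τ.SemidirectGroup) : rigidMotionHom e he x 0 = e x.left.toAdd := by
  simp [rigidMotionHom]

theorem isCompact_setOf_norm_rigidMotionHom_apply_zero_le [TopologicalSpace K] [CompactSpace K]
    [TopologicalSpace V] [ProperSpace E]
    (e : V ≃L[ℝ] E) (he : ∀ k v, e (τ k v) = σ k (e v)) (R : ℝ) :
    IsCompact {x : τ.SemidirectGroup | ‖rigidMotionHom e.toLinearMap he x 0‖ ≤ R} := by
  have hind : Topology.IsInducing
      (fun x : τ.SemidirectGroup => ((x.left, x.right) : Multiplicative V × K)) := ⟨rfl⟩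
  have hrange : Set.range
      (fun x : τ.SemidirectGroup => ((x.left, x.right) : Multiplicative V × K)) = Set.univ :=
    Set.range_eq_univ.2 fun p => ⟨⟨p.1, p.2⟩, rfl⟩
  have hball : IsCompact ((fun v : Multiplicative V => e v.toAdd) ⁻¹' Metric.closedBall 0 R) :=
    e.toHomeomorph.isCompact_preimage.2 (isCompact_closedBall 0 R)
  convert hind.isCompact_preimage (hrange ▸ isClosed_univ) (hball.prod isCompact_univ) using 1
  ext x
  simp [rigidMotionHom_apply_zero]

end SemidirectGroup

theorem mainTheorem12 {K V : Type*} [Group K] [TopologicalSpace K] [IsTopologicalGroup K]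
    [CompactSpace K] [NormedAddCommGroup V] [NormedSpace ℝ V] [FiniteDimensional ℝ V]
    (τ : Representation ℝ K V) (hτ : Continuous fun p : K × V => τ p.1 p.2)
    (Γ : Subgroup τ.SemidirectGroup) (hΓ : DiscreteTopology Γ) :
    ∃ W : Submodule ℝ V,
      StronglySimilar (Γ : Set τ.SemidirectGroup) (τ.translation '' (W : Set V)) := by
  have := τ.isTopologicalGroup_semidirectGroup hτ
  obtain ⟨e, σ, he⟩ := exists_conj_linearIsometryEquiv fun v => hτ.comp (Continuous.prodMk_left v)
  have hproper := isCompact_setOf_norm_rigidMotionHom_apply_zero_le e he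
  obtain ⟨W, hW⟩ := exists_submodule_hausdorffEDist_ne_top_of_discrete hproper Γ
  refine ⟨W.comap e.toLinearMap, stronglySimilar_of_hausdorffEDist_ne_top hproper ?_⟩
  have himage : (rigidMotionHom e.toLinearMap he · 0) ''
      (τ.translation '' (W.comap e.toLinearMap : Set V)) = W := by
    rw [Set.image_image]
    simp only [rigidMotionHom_apply_zero]
    exact Set.image_preimage_eq _ e.surjective
  rwa [himage]
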